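/- Let $X$ be a countably infinite discrete set, $m:X\to(0,\infty)$, and let $\ell^2(X,m)$ be the real Hilbert space of all $u:X\to\mathbb R$ with $\sum_x u(x)^2m(x)<\infty$, with inner product $\langle u,v\rangle=\sum_x u(x)v(x)m(x)$. Let $C_0(X)$ be the space of finitely supported functions $X\to\mathbb R$. Let $b:X\times X\to[0,\infty)$ be a weighted graph, i.e. $b(x,x)=0$, $b(x,y)=b(y,x)$ and $\sum_{y}b(x,y)<\infty$ for all $x,y\in X$, and suppose that $b$ is connected: any two points of $X$ are joined by a finite path along pairs with $b>0$. Let $F(X)$ be the set of all $u:X\to\mathbb R$ with $\sum_y b(x,y)|u(y)|<\infty$ for all $x\in X$. For $c:X\to\mathbb R$ put $$Q_{b,c}(u,v)=\sum_{x,y\in X}b(x,y)\,(u(x)-u(y))(v(x)-v(y))+\sum_{x\in X}u(x)v(x)c(x),$$ which in particular is defined for $u\in F(X)$ and $v\in C_0(X)$. Let $c:X\to\mathbb R$ and suppose that $Q=Q_{b,c}$, with domain the closure of $C_0(X)$ in the energy norm $\|u\|_Q=(Q(u,u)+\|u\|^2)^{1/2}$, is a regular Dirichlet form on $\ell^2(X,m)$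 (a densely defined, symmetric, nonnegative, closed form, compatible with normal contractions, such that the finitely supported functions in its domain $D(Q)$ are dense in $D(Q)$ for $\|\cdot\|_Q$ and in $C_0(X)$ for the supremum norm). Let $H$ be the self-adjoint operator on $\ell^2(X,m)$ associated with $Q$, and $\sigma(H)$ its spectrum. Let $W:X\to\mathbb R$ be bounded, and suppose that $H+W$ is critical with ground state $\varphi$. That is, with $\tilde c(x)=c(x)+W(x)m(x)$ (so that $Q_{b,\tilde c}$ is the form of $H+W$): * $Q_{b,\tilde c}(v,v)\ge 0$ for all $v\in C_0(X)$, and there is no $w:X\to[0,\infty)$, $w\neq0$, such that $Q_{b,\tilde c}(v,v)\ge\sum_x w(x)v(x)^2$ for all $v\in C_0(X)$; * $\varphi\in F(X)$ is strictly positive and $(H+W)$-harmonic: $Q_{b,\tilde c}(\varphi,v)=0$ for all $v\in C_0(X)$. Let $\lambda\in\mathbb R$ and let $u\in F(X)$ be a generalized eigenfunction of $H$ with eigenvalue $\lambda$, i.e. $u\ne0$ and $Q_{b,c}(u,v)=\lambda\sum_x u(x)v(x)m(x)$ for all $v\in C_0(X)$. If $|u(x)|\le\varphi(x)$ for all $x\in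 X$, then $\lambda\in\sigma(H)$. -/

import Mathlib

open scoped InnerProductSpace

noncomputable section

/-! ### Closed forms, their operators, and the spectrum -/

/-- A densely defined, symmetric, nonnegative, closed form on a real Hilbert space. -/
structure ClosedForm (E : Type*) [NormedAddCommGroup E] [InnerProductSpace ℝ E] where
  domain : Submodule ℝ E
  dense_domain : Dense (domain : Set E)
  form : domain →ₗ[ℝ] domain →ₗ[ℝ] ℝ
  symm : ∀ u v : domain, form u v = form v u
  nonneg : ∀ u : domain, 0 ≤ form u u
  /-- The domain is complete in the energy norm `‖u‖_Q ^ 2 = Q(u,u) + ‖u‖ ^ 2`. -/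
  closed : ∀ u : ℕ → domain,
    (∀ ε : ℝ, 0 < ε → ∃ N : ℕ, ∀ n k : ℕ, N ≤ n → N ≤ k →
      form (u n - u k) (u n - u k) + ‖u n - u k‖ ^ 2 < ε) →
    ∃ v : domain, Filter.Tendsto
      (fun n => form (u n - v) (u n - v) + ‖u n - v‖ ^ 2) Filter.atTop (nhds 0)

namespace ClosedForm

variable {E : Type*} [NormedAddCommGroup E] [InnerProductSpace ℝ E] (Q : ClosedForm E)

/-- The square of the energy norm. -/
def energySq (u : Q.domain) : ℝ := Q.form u u + ‖u‖ ^ 2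

/-- The graph of the operator associated with the form: all `(ψ, g)` with `ψ` in the form domain
and `Q(ψ, u) = ⟪g, u⟫` for every `u` in the form domain. -/
def operatorGraph : Submodule ℝ (E × E) where
  carrier := {p | ∃ h : p.1 ∈ Q.domain, ∀ u : Q.domain, Q.form ⟨p.1, h⟩ u = ⟪p.2, (u : E)⟫_ℝ}
  zero_mem' := ⟨Q.domain.zero_mem, fun u => by
    have h0 : (⟨(0 : E × E).1, Q.domain.zero_mem⟩ : Q.domain) = 0 := rfl
    rw [h0, map_zero, LinearMap.zero_apply, Prod.snd_zero, inner_zero_left]⟩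
  add_mem' := by
    rintro ⟨a, g⟩ ⟨a', g'⟩ ⟨h, hg⟩ ⟨h', hg'⟩
    refine ⟨Q.domain.add_mem h h', fun u => ?_⟩
    have e : (⟨a + a', Q.domain.add_mem h h'⟩ : Q.domain) = ⟨a, h⟩ + ⟨a', h'⟩ := rfl
    have h1 := hg u
    have h2 := hg' u
    simp only [Prod.mk_add_mk] at h1 h2 ⊢
    rw [e, map_add, LinearMap.add_apply, h1, h2, inner_add_left]
  smul_mem' := by
    rintro r ⟨a, g⟩ ⟨h, hg⟩
    refine ⟨Q.domain.smul_mem r h, fun u => ?_⟩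
    have e : (⟨r • a, Q.domain.smul_mem r h⟩ : Q.domain) = r • ⟨a, h⟩ := rfl
    have h1 := hg u
    simp only [Prod.smul_mk] at h1 ⊢
    rw [e, map_smul, LinearMap.smul_apply, h1, real_inner_smul_left, smul_eq_mul]

/-- The self-adjoint operator `H` associated with the form: `Q(ψ, u) = ⟪H ψ, u⟫` for all
`ψ ∈ D(H)`, `u ∈ D(Q)`, with the largest possible domain `D(H) ⊆ D(Q)`. -/
def operator : E →ₗ.[ℝ] E := Q.operatorGraph.toLinearPMap

theorem operatorGraph_single_valued (p : E × E) (hp : p ∈ Q.operatorGraph) (h0 : p.1 = 0) :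
    p.2 = 0 := by
  obtain ⟨a, g⟩ := p
  obtain ⟨h, hg⟩ := hp
  simp only at h0 hg ⊢
  subst h0
  have e : (⟨0, h⟩ : Q.domain) = 0 := rfl
  refine Q.dense_domain.eq_zero_of_inner_left (𝕜 := ℝ) (fun u hu => ?_)
  have := hg ⟨u, hu⟩
  rw [e, map_zero, LinearMap.zero_apply] at this
  exact this.symm

/-- The graph of the associated operator is the one described above. -/
theorem graph_operator : Q.operator.graph = Q.operatorGraph :=
  Submodule.toLinearPMap_graph_eq _ (fun p hp h0 => Q.operatorGraph_single_valued p hp h0)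

end ClosedForm

/-- `lam` belongs to the resolvent set of the (unbounded) operator `H`: the map
`H - lam : D(H) → E` is bijective with bounded inverse. -/
def InResolventSet {E : Type*} [NormedAddCommGroup E] [InnerProductSpace ℝ E]
    (H : E →ₗ.[ℝ] E) (lam : ℝ) : Prop :=
  ∃ R : E →L[ℝ] E,
    (∀ f : E, ∃ h : R f ∈ H.domain, H ⟨R f, h⟩ - lam • R f = f) ∧
    (∀ u : H.domain, R (H u - lam • (u : E)) = u)

/-- The (real) spectrum of an unbounded operator. For self-adjoint operators it is the whole
spectrum of the complexification. -/
def operatorSpectrum {E : Type*} [NormedAddCommGroup E] [InnerProductSpace ℝ E]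
    (H : E →ₗ.[ℝ] E) : Set ℝ :=
  {lam | ¬ InResolventSet H lam}

/-! ### The space `ℓ²(X, m)` and regular Dirichlet forms on it -/

/-- The measure on `X` giving the point `x` the mass `m x`. -/
def pointMeasure {X : Type*} [MeasurableSpace X] (m : X → ℝ) : MeasureTheory.Measure X :=
  MeasureTheory.Measure.sum fun x => ENNReal.ofReal (m x) • MeasureTheory.Measure.dirac x

/-- The real Hilbert space `ℓ²(X, m)`. As `m` is positive in all uses below, almost everywhere
equal functions are equal, so that elements may be evaluated at points. -/
abbrev ell2 {X : Type*} [MeasurableSpace X] (m : X → ℝ) : Type _ :=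
  MeasureTheory.Lp ℝ 2 (pointMeasure m)

/-- Membership in `C_0(X)`, the functions of finite support on the discrete set `X`. -/
def FinSupp {X : Type*} (v : X → ℝ) : Prop := (Function.support v).Finite

section Dirichlet

variable {X : Type*} [MeasurableSpace X] {m : X → ℝ}

/-- The Markov property: `Q` is compatible with all normal contractions. -/
def IsDirichletForm (Q : ClosedForm (ell2 m)) : Prop :=
  ∀ (T : ℝ → ℝ) (hT : LipschitzWith 1 T) (hT0 : T 0 = 0) (u : Q.domain),
    ∃ h : hT.compLp hT0 (u : ell2 m) ∈ Q.domain,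
      Q.form ⟨hT.compLp hT0 (u : ell2 m), h⟩ ⟨hT.compLp hT0 (u : ell2 m), h⟩ ≤ Q.form u u

/-- A Dirichlet form is regular if `D ∩ C_0(X)` is dense in `D` for the energy norm and in
`C_0(X)` for the supremum norm. -/
def IsRegularDirichletForm (Q : ClosedForm (ell2 m)) : Prop :=
  IsDirichletForm Q ∧
  (∀ (u : Q.domain) (ε : ℝ), 0 < ε →
    ∃ v : Q.domain, FinSupp (v : ell2 m) ∧ Q.energySq (u - v) < ε) ∧
  (∀ (f : X → ℝ), FinSupp f → ∀ ε : ℝ, 0 < ε →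
    ∃ v : Q.domain, FinSupp (v : ell2 m) ∧ ∀ x, |f x - (v : ell2 m) x| < ε)

end Dirichlet

/-! ### Weighted graphs -/

/-- A symmetric weighted graph over `X`. -/
structure WeightedGraph (X : Type*) where
  b : X → X → ℝ
  nonneg : ∀ x y, 0 ≤ b x y
  diag : ∀ x, b x x = 0
  symm : ∀ x y, b x y = b y x
  summable : ∀ x, Summable fun y => b x y

namespace WeightedGraph

variable {X : Type*} (G : WeightedGraph X)

/-- `x` and `y` are neighbours if `b(x,y) > 0`. -/
def toSimpleGraph : SimpleGraph X where
  Adj x y := 0 < G.b x y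
  symm := ⟨fun x y h => by rw [G.symm y x]; exact h⟩
  loopless := ⟨fun x h => by rw [G.diag x] at h; exact lt_irrefl _ h⟩

/-- `Q_{b,c}(u,v) = ∑_{x,y} b(x,y) (u(x)-u(y)) (v(x)-v(y)) + ∑_x u(x) v(x) c(x)`, the first sum
being over ordered pairs. If `u ∈ F(X)` and `v ∈ C_0(X)`, both sums converge absolutely. -/
def bilin (c u v : X → ℝ) : ℝ :=
  (∑' p : X × X, G.b p.1 p.2 * (u p.1 - u p.2) * (v p.1 - v p.2)) + ∑' x, u x * v x * c x

/-- Membership in `F(X)`: the functions `u` with `∑_y b(x,y) |u(y)| < ∞` for every `x`. -/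
def MemF (u : X → ℝ) : Prop := ∀ x, Summable fun y => G.b x y * |u y|

/-- `Q = Q_{b,c}`: the domain of `Q` is the closure of `C_0(X)` in the energy norm, and `Q` is
given there by the formula for `Q_{b,c}`. -/
def IsGraphForm [MeasurableSpace X] {m : X → ℝ} (Q : ClosedForm (ell2 m)) (c : X → ℝ) : Prop :=
  (∀ v : ell2 m, FinSupp v → v ∈ Q.domain) ∧
  (∀ (u : Q.domain) (ε : ℝ), 0 < ε →
    ∃ v : Q.domain, FinSupp (v : ell2 m) ∧ Q.energySq (u - v) < ε) ∧
  (∀ u v : Q.domain, Q.form u v = G.bilin c (u : ell2 m) (v : ell2 m))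

/-- The potential of the form of `H + W`, where `H` is the operator of `Q_{b,c}` on `ℓ²(X,m)`:
`⟨(H + W) u, u⟩ = Q_{b,c}(u) + ∑_x W(x) u(x)² m(x)`. -/
def shift (m c W : X → ℝ) : X → ℝ := fun x => c x + W x * m x

/-- `Q_{b,c} ≥ 0` on `C_0(X)`. -/
def NonnegForm (c : X → ℝ) : Prop := ∀ v : X → ℝ, FinSupp v → 0 ≤ G.bilin c v v

/-- `Q_{b,c}` (nonnegative on `C_0(X)`) is subcritical if `Q_{b,c} - Q_w ≥ 0` on `C_0(X)` for some
nonzero `w : X → [0,∞)`, where `Q_w(v) = ∑_x w(x) v(x)²`. -/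
def Subcritical (c : X → ℝ) : Prop :=
  ∃ w : X → ℝ, (∀ x, 0 ≤ w x) ∧ w ≠ 0 ∧
    ∀ v : X → ℝ, FinSupp v → 0 ≤ G.bilin c v v - ∑' x, w x * v x ^ 2

/-- `Q_{b,c}` is critical: nonnegative on `C_0(X)` and not subcritical. -/
def Critical (c : X → ℝ) : Prop := G.NonnegForm c ∧ ¬ G.Subcritical c

/-- `u ∈ F(X)` is harmonic for the operator of `Q_{b,c}` (tested against `C_0(X)`). -/
def Harmonic (c u : X → ℝ) : Prop :=
  G.MemF u ∧ ∀ v : X → ℝ, FinSupp v → G.bilin c u v = 0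

/-- The ground state of a critical operator: its strictly positive harmonic function (which in the
critical case exists and is unique up to a multiplicative constant). -/
def GroundState (c φ : X → ℝ) : Prop := (∀ x, 0 < φ x) ∧ G.Harmonic c φ

/-- A generalized eigenfunction in `F(X)` of the operator of `Q_{b,c}` on `ℓ²(X,m)`: a nonzero
`u ∈ F(X)` with `Q_{b,c}(u,v) = lam ⟨u,v⟩` for every `v ∈ C_0(X)`. -/
def GeneralizedEigenfunction (m c : X → ℝ) (lam : ℝ) (u : X → ℝ) : Prop :=
  u ≠ 0 ∧ G.MemF u ∧
    ∀ v : X → ℝ, FinSupp v → G.bilin c u v = lam * ∑' x, u x * v x * m x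

end WeightedGraph

end

/-! ### Graph forms: finitely supported functions and summability. -/

noncomputable section

/-! A Shnol-type argument by contradiction. Criticality yields finitely supported cut-offs `η` with
`η x₀ = 1` and `Q_{b,c̃}(φη)` arbitrarily small (`Critical.exists_small`). With `u x₀ ≠ 0`, the
function `w = uη` is an approximate eigenfunction whose norm stays bounded below by its value at
`x₀`.

To see this, write `u = φh` with `|h| ≤ 1` and `v = φg`. The ground state transform removes the
potential `c̃`, so `Q(uη,v) - lam⟪uη,v⟫` becomes a commutator of the transformed form with `η`.
Young's inequality with weight `T` and a Caccioppoli bound (`bilin_commutator_le`) control twice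
this by `T Q_{b,c̃}(φη) + T⁻¹ M ‖v‖_Q²`, with `M` independent of `η`
(`GeneralizedEigenfunction.cutoff_le`).

If `lam` were in the resolvent set, `ψ = (H - lam)⁻¹ w` would have energy at most a constant times
`‖w‖²`. Taking `v = ψ` turns the left side into `2‖w‖²`. For `T` large the last term is absorbed, so
`‖w‖² ≤ T Q_{b,c̃}(φη)`, which a suitable `η` makes smaller than the lower bound. -/

theorem FinSupp.mul_left {X : Type*} {v : X → ℝ} (hv : FinSupp v) (f : X → ℝ) :
    FinSupp fun x => f x * v x :=
  hv.subset (Function.support_mul_subset_right f v)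

theorem FinSupp.summable {X : Type*} {v : X → ℝ} (hv : FinSupp v) : Summable v :=
  summable_of_hasFiniteSupport hv

namespace WeightedGraph

variable {X : Type*} {G : WeightedGraph X} {c φ h g η u v : X → ℝ}

theorem memF_of_bounded {C : ℝ} (hu : ∀ x, |u x| ≤ C) : G.MemF u := fun x =>
  ((G.summable x).mul_right C).of_nonneg_of_le
    (fun y => mul_nonneg (G.nonneg x y) (abs_nonneg _))
    fun y => mul_le_mul_of_nonneg_left (hu y) (G.nonneg x y)

theorem memF_one : G.MemF fun _ => 1 := memF_of_bounded (C := 1) (by simp)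

theorem memF_of_finSupp (hv : FinSupp v) : G.MemF v := fun x =>
  summable_of_hasFiniteSupport (hv.subset fun y hy => by
    simp only [Function.mem_support, ne_eq, mul_eq_zero, abs_eq_zero, not_or] at hy ⊢
    exact hy.2)

theorem summable_mul_fst (hv : FinSupp v) (hu : G.MemF u) :
    Summable fun z : X × X => G.b z.1 z.2 * (v z.1 * u z.2) := by
  refine Summable.of_abs ?_
  rw [summable_prod_of_nonneg (fun z => abs_nonneg _)]
  have key : ∀ x, (fun y => |G.b x y * (v x * u y)|) = fun y => |v x| * (G.b x y * |u y|) := by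
    intro x
    funext y
    rw [abs_mul, abs_mul, abs_of_nonneg (G.nonneg x y)]
    ring
  refine ⟨fun x => ?_, ?_⟩
  · simp only [key]
    exact (hu x).mul_left _
  · simp only [key, tsum_mul_left]
    refine summable_of_hasFiniteSupport (hv.subset fun x hx => ?_)
    simp only [Function.mem_support, ne_eq, mul_eq_zero, abs_eq_zero, not_or] at hx ⊢
    exact hx.1

theorem summable_mul_snd (hv : FinSupp v) (hu : G.MemF u) :
    Summable fun z : X × X => G.b z.1 z.2 * (u z.1 * v z.2) := by
  refine ((Equiv.prodComm X X).summable_iff.mpr (G.summable_mul_fst hv hu)).congr fun z => ?_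
  simp only [Function.comp, Equiv.prodComm_apply, Prod.fst_swap, Prod.snd_swap]
  rw [G.symm]
  ring

theorem summable_bilin (hu : G.MemF u) (hv : FinSupp v) :
    Summable fun z : X × X => G.b z.1 z.2 * (u z.1 - u z.2) * (v z.1 - v z.2) := by
  -- Expanding the product gives four sums; in the two diagonal ones `u v` is paired with the
  -- constant 1.
  have h1 := G.summable_mul_fst (hv.mul_left u) G.memF_one
  have h2 := G.summable_mul_snd (hv.mul_left u) G.memF_one
  have h3 := G.summable_mul_fst hv hu
  have h4 := G.summable_mul_snd hv hu
  exact (((h1.add h2).sub h3).sub h4).congr fun z => by ring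

theorem bilin_shift {m W : X → ℝ} (hv : FinSupp v) :
    G.bilin (shift m c W) u v = G.bilin c u v + ∑' x, W x * (u x * v x * m x) := by
  have h1 : Summable fun x => u x * v x * c x :=
    ((hv.mul_left u).mul_left c).summable.congr fun x => by ring
  have h2 : Summable fun x => W x * (u x * v x * m x) :=
    ((hv.mul_left u).mul_left fun x => W x * m x).summable.congr fun x => by ring
  rw [bilin, bilin, add_assoc, ← h1.tsum_add h2]
  congr 2
  funext x
  rw [shift]
  ring

/-! ### Ground state transform, commutator estimate and cut-offs. -/

/-- The graph `b(x,y) φ(x) φ(y)`, on which the form conjugated by `φ` lives. -/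
def conj (G : WeightedGraph X) (φ : X → ℝ) (hφ : ∀ x, 0 < φ x) (hF : G.MemF φ) :
    WeightedGraph X where
  b x y := G.b x y * φ x * φ y
  nonneg x y := mul_nonneg (mul_nonneg (G.nonneg x y) (hφ x).le) (hφ y).le
  diag x := by rw [G.diag, zero_mul, zero_mul]
  symm x y := by rw [G.symm]; ring
  summable x := ((hF x).mul_left (φ x)).congr fun y => by rw [abs_of_pos (hφ y)]; ring

/-- The ground state transform. -/
theorem bilin_groundState (hgs : G.GroundState c φ) (hh : G.MemF fun x => φ x * h x)
    (hg : FinSupp g) :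
    G.bilin c (fun x => φ x * h x) (fun x => φ x * g x) =
      (G.conj φ hgs.1 hgs.2.1).bilin 0 h g := by
  have hK : (G.conj φ hgs.1 hgs.2.1).MemF h := fun x =>
    ((hh x).mul_left (φ x)).congr fun y => by
      rw [abs_mul, abs_of_pos (hgs.1 y), conj]
      ring
  have hfin : FinSupp fun x => φ x * h x * g x := hg.mul_left fun x => φ x * h x
  have h0 := hgs.2.2 _ hfin
  have h1 := (summable_bilin hK hg).tsum_add (summable_bilin hgs.2.1 hfin)
  rw [bilin] at h0 ⊢
  rw [bilin]
  -- Pointwise product rule: the second summand, together with the potential term, is the form of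
  -- `φ` tested against `φhg`, which vanishes by harmonicity.
  have e1 : ∀ z : X × X, G.b z.1 z.2 * (φ z.1 * h z.1 - φ z.2 * h z.2) *
      (φ z.1 * g z.1 - φ z.2 * g z.2) =
      (G.conj φ hgs.1 hgs.2.1).b z.1 z.2 * (h z.1 - h z.2) * (g z.1 - g z.2) +
      G.b z.1 z.2 * (φ z.1 - φ z.2) * (φ z.1 * h z.1 * g z.1 - φ z.2 * h z.2 * g z.2) := by
    intro z
    simp only [conj]
    ring
  have e2 : ∀ x, φ x * h x * (φ x * g x) * c x = φ x * (φ x * h x * g x) * c x := by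
    intro x; ring
  simp only [e1, e2, h1, Pi.zero_apply, mul_zero, tsum_zero]
  linarith

/-- The commutator of the form with multiplication by `η`, bounded by a Caccioppoli inequality. -/
theorem bilin_commutator_le (hh : ∀ x, |h x| ≤ 1) (hη : FinSupp η) (hg : FinSupp g) {T : ℝ}
    (hT : 0 < T) :
    2 * (G.bilin 0 (fun x => h x * η x) g - G.bilin 0 h (fun x => η x * g x)) ≤
      T * G.bilin 0 η η +
        T⁻¹ * (10 * G.bilin 0 g g + 2 * G.bilin 0 h (fun x => h x * g x * g x)) := by
  have hhF : G.MemF h := memF_of_bounded hh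
  have s1 := summable_bilin (memF_of_finSupp (G := G) (hη.mul_left h)) hg
  have s2 := summable_bilin hhF (hg.mul_left η)
  have s3 := summable_bilin (memF_of_finSupp (G := G) hη) hη
  have s4 := summable_bilin (memF_of_finSupp (G := G) hg) hg
  have s5 := summable_bilin hhF (hg.mul_left fun x => h x * g x)
  simp only [bilin, Pi.zero_apply, mul_zero, tsum_zero, add_zero]
  rw [← s1.tsum_sub s2, ← tsum_mul_left, ← tsum_mul_left, ← tsum_mul_left, ← tsum_mul_left,
    ← (s4.mul_left 10).tsum_add (s5.mul_left 2), ← tsum_mul_left,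
    ← (s3.mul_left T).tsum_add (((s4.mul_left 10).add (s5.mul_left 2)).mul_left T⁻¹)]
  -- The comparison is made edge by edge: the commutator contributes `b(x,y) (η x - η y) (h y g x -
  -- h x g y)`.
  refine Summable.tsum_le_tsum (fun z => ?_) ((s1.sub s2).mul_left 2)
    ((s3.mul_left T).add (((s4.mul_left 10).add (s5.mul_left 2)).mul_left T⁻¹))
  obtain ⟨x, y⟩ := z
  have hb := G.nonneg x y
  -- In means and differences the left side is `(se - dσ)²`, and right minus left is `10(1 - s²)e² +
  -- (dσ + 3se)² + d²e²/2`; hence the constant 10 = 1 + 9.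
  have key : (h y * g x - h x * g y) ^ 2 ≤
      10 * (g x - g y) ^ 2 + 2 * ((h x - h y) * (h x * g x * g x - h y * g y * g y)) := by
    set s := (h x + h y) / 2 with hs
    set d := h x - h y with hd
    set σ := (g x + g y) / 2 with hσ
    set e := g x - g y with he
    have hs1 : s ^ 2 ≤ 1 := by
      have := abs_le.mp (hh x)
      have := abs_le.mp (hh y)
      rw [sq_le_one_iff_abs_le_one, abs_le]
      constructor <;> linarith
    have e1 : h x = s + d / 2 := by rw [hs, hd]; ring
    have e2 : h y = s - d / 2 := by rw [hs, hd]; ring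
    have e3 : g x = σ + e / 2 := by rw [hσ, he]; ring
    have e4 : g y = σ - e / 2 := by rw [hσ, he]; ring
    rw [e1, e2, e3, e4]
    have a1 := mul_le_mul_of_nonneg_right hs1 (sq_nonneg e)
    have a2 := sq_nonneg (d * σ + 3 * (s * e))
    have a3 := sq_nonneg (d * e)
    linarith
  have amgm : 2 * ((η x - η y) * (h y * g x - h x * g y)) ≤
      T * (η x - η y) ^ 2 + T⁻¹ * (h y * g x - h x * g y) ^ 2 := by
    have := mul_nonneg (inv_nonneg.mpr hT.le)
      (sq_nonneg (T * (η x - η y) - (h y * g x - h x * g y)))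
    have hTT : T⁻¹ * T = 1 := inv_mul_cancel₀ hT.ne'
    have e : T⁻¹ * (T * (η x - η y) - (h y * g x - h x * g y)) ^ 2 =
        (T⁻¹ * T) * T * (η x - η y) ^ 2 -
          (T⁻¹ * T) * (2 * ((η x - η y) * (h y * g x - h x * g y))) +
          T⁻¹ * (h y * g x - h x * g y) ^ 2 := by ring
    rw [e, hTT] at this
    linarith
  have := mul_le_mul_of_nonneg_left
    (amgm.trans (add_le_add_right (mul_le_mul_of_nonneg_left key (inv_nonneg.mpr hT.le)) _)) hb
  simp only
  linarith

/-- Failure of subcriticality for the weight `δ` concentrated at `x₀` gives `v` with form value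
below `δ v(x₀)²`. Nonnegativity forces `v x₀ ≠ 0`, so `v` can be rescaled to equal `φ` at `x₀` and
then divided by `φ`. -/
theorem Critical.exists_small (hc : G.Critical c) (hφ : ∀ x, 0 < φ x) (x₀ : X) {ε : ℝ}
    (hε : 0 < ε) :
    ∃ η : X → ℝ, FinSupp η ∧ η x₀ = 1 ∧
      G.bilin c (fun x => φ x * η x) (fun x => φ x * η x) < ε := by
  classical
  set δ := ε / φ x₀ ^ 2 with hδ
  have hφ0 : 0 < φ x₀ ^ 2 := pow_pos (hφ x₀) 2
  have hδ0 : 0 < δ := div_pos hε hφ0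
  have hns : ∃ v : X → ℝ, FinSupp v ∧ G.bilin c v v < δ * v x₀ ^ 2 := by
    by_contra! hcon
    refine hc.2 ⟨Pi.single x₀ δ, fun x => ?_, ?_, fun v hv => ?_⟩
    · exact Pi.single_nonneg (i := x₀) (α := fun _ : X => ℝ) |>.mpr hδ0.le x
    · simpa using hδ0.ne'
    · rw [tsum_eq_single x₀ fun x hx => by rw [Pi.single_eq_of_ne hx, zero_mul],
        Pi.single_eq_same]
      exact sub_nonneg.mpr (hcon v hv)
  obtain ⟨v, hv, hlt⟩ := hns
  have hv0 : v x₀ ≠ 0 := by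
    intro h0
    rw [h0] at hlt
    have := hc.1 v hv
    linarith
  set r := φ x₀ / v x₀ with hr
  refine ⟨fun x => r / φ x * v x, hv.mul_left _, ?_, ?_⟩
  · rw [hr]
    have := (hφ x₀).ne'
    field_simp
  · have e : (fun x => φ x * (r / φ x * v x)) = fun x => r * v x := by
      funext x
      have := (hφ x).ne'
      field_simp
    have e2 : G.bilin c (fun x => r * v x) (fun x => r * v x) = r ^ 2 * G.bilin c v v := by
      rw [bilin, bilin, mul_add, ← tsum_mul_left, ← tsum_mul_left]
      congr 1 <;> exact tsum_congr fun z => by ring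
    rw [e, e2]
    have hr2 : 0 < r ^ 2 := by
      have := (hφ x₀).ne'
      positivity
    calc r ^ 2 * G.bilin c v v < r ^ 2 * (δ * v x₀ ^ 2) := mul_lt_mul_of_pos_left hlt hr2
      _ = ε := by
        rw [hr, hδ]
        have := (hφ x₀).ne'
        field_simp

/-- The approximate eigenvalue equation satisfied by a cut-off generalized eigenfunction that is
dominated by the ground state. -/
theorem GeneralizedEigenfunction.cutoff_le {m W : X → ℝ} (hm : ∀ x, 0 < m x) {C lam : ℝ}
    (hW : ∀ x, |W x| ≤ C) (hgs : G.GroundState (shift m c W) φ)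
    (hu : G.GeneralizedEigenfunction m c lam u) (hle : ∀ x, |u x| ≤ φ x)
    (hη : FinSupp η) (hv : FinSupp v) {T : ℝ} (hT : 0 < T) :
    2 * (G.bilin c (fun x => u x * η x) v - lam * ∑' x, u x * η x * v x * m x) ≤
      T * G.bilin (shift m c W) (fun x => φ x * η x) (fun x => φ x * η x) +
        T⁻¹ * (10 * G.bilin c v v + (12 * C + 2 * |lam|) * ∑' x, v x * v x * m x) := by
  set h : X → ℝ := fun x => u x / φ x with hhdef
  set g : X → ℝ := fun x => (φ x)⁻¹ * v x with hgdef
  have hφ0 : ∀ x, φ x ≠ 0 := fun x => (hgs.1 x).ne'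
  have huh : ∀ x, u x = φ x * h x := fun x => by
    have := hφ0 x
    simp only [hhdef]; field_simp
  have hvg : ∀ x, v x = φ x * g x := fun x => by
    have := hφ0 x
    simp only [hgdef]; field_simp
  have hh : ∀ x, |h x| ≤ 1 := fun x => by
    rw [hhdef, abs_div, abs_of_pos (hgs.1 x)]
    exact div_le_one_of_le₀ (hle x) (hgs.1 x).le
  have hg : FinSupp g := hv.mul_left _
  have hηF := memF_of_finSupp (G := G) (hη.mul_left φ)
  have hgF := memF_of_finSupp (G := G) (hg.mul_left φ)
  have hhF : G.MemF fun x => φ x * h x := by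
    have := hu.2.1
    rwa [show u = fun x => φ x * h x from funext huh] at this
  -- the equation for `u`, tested against a finitely supported function
  have eqn : ∀ p : X → ℝ, FinSupp p → (G.conj φ hgs.1 hgs.2.1).bilin 0 h p =
      ∑' x, (lam + W x) * (u x * (φ x * p x) * m x) := by
    intro p hp
    have hφp := hp.mul_left φ
    rw [← bilin_groundState hgs hhF hp, ← show u = fun x => φ x * h x from funext huh,
      bilin_shift hφp, hu.2.2 _ hφp, ← tsum_mul_left, ← Summable.tsum_add]
    · exact tsum_congr fun x => by ring
    · exact (hφp.mul_left fun x => lam * (u x * m x)).summable.congr fun x => by ring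
    · exact (hφp.mul_left fun x => W x * (u x * m x)).summable.congr fun x => by ring
  have hmain := bilin_commutator_le (G := G.conj φ hgs.1 hgs.2.1) hh hη hg hT
  -- The `W`-sums here and in `t2` coincide, so they cancel in the commutator.
  have t1 : (G.conj φ hgs.1 hgs.2.1).bilin 0 (fun x => h x * η x) g =
      G.bilin c (fun x => u x * η x) v + ∑' x, W x * (u x * η x * v x * m x) := by
    rw [← bilin_groundState hgs (memF_of_finSupp ((hη.mul_left h).mul_left φ)) hg,
      ← show v = fun x => φ x * g x from funext hvg, bilin_shift hv]
    simp only [huh, mul_assoc]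
  have t2 : (G.conj φ hgs.1 hgs.2.1).bilin 0 h (fun x => η x * g x) =
      lam * ∑' x, u x * η x * v x * m x + ∑' x, W x * (u x * η x * v x * m x) := by
    rw [eqn _ (hg.mul_left η), ← tsum_mul_left, ← Summable.tsum_add]
    · exact tsum_congr fun x => by rw [hvg x]; ring
    · exact (hv.mul_left fun x => lam * (u x * η x * m x)).summable.congr fun x => by ring
    · exact (hv.mul_left fun x => W x * (u x * η x * m x)).summable.congr fun x => by ring
  have t3 := bilin_groundState hgs hηF hη
  have sv : Summable fun x => v x * v x * m x :=
    ((hv.mul_left v).mul_left m).summable.congr fun x => by ring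
  have t4 : (G.conj φ hgs.1 hgs.2.1).bilin 0 g g ≤
      G.bilin c v v + C * ∑' x, v x * v x * m x := by
    rw [← bilin_groundState hgs hgF hg, ← show v = fun x => φ x * g x from funext hvg,
      bilin_shift hv, ← tsum_mul_left]
    refine add_le_add_right (Summable.tsum_le_tsum (fun x => ?_) ?_ (sv.mul_left C)) _
    · exact mul_le_mul_of_nonneg_right ((le_abs_self _).trans (hW x))
        (mul_nonneg (mul_self_nonneg _) (hm x).le)
    · exact (hv.mul_left fun x => W x * (v x * m x)).summable.congr fun x => by ring
  -- The Caccioppoli term is the equation for `u` tested against `h g²`; only `|h| ≤ 1` and the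
  -- bound on `W` enter.
  have t5 : (G.conj φ hgs.1 hgs.2.1).bilin 0 h (fun x => h x * g x * g x) ≤
      (|lam| + C) * ∑' x, v x * v x * m x := by
    rw [eqn _ (hg.mul_left fun x => h x * g x), ← tsum_mul_left]
    refine Summable.tsum_le_tsum (fun x => ?_) ?_ (sv.mul_left _)
    · have e : (lam + W x) * (u x * (φ x * (h x * g x * g x)) * m x) =
          (lam + W x) * h x ^ 2 * (v x * v x * m x) := by
        rw [huh x, hvg x]; ring
      rw [e]
      refine mul_le_mul_of_nonneg_right ?_ (mul_nonneg (mul_self_nonneg _) (hm x).le)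
      have h2 : h x ^ 2 ≤ 1 := by
        rw [sq_le_one_iff_abs_le_one]; exact hh x
      have h3 : lam + W x ≤ |lam| + C :=
        add_le_add (le_abs_self _) ((le_abs_self _).trans (hW x))
      have h4 : 0 ≤ |lam| + C := add_nonneg (abs_nonneg _) ((abs_nonneg _).trans (hW x))
      calc (lam + W x) * h x ^ 2 ≤ (|lam| + C) * h x ^ 2 :=
            mul_le_mul_of_nonneg_right h3 (sq_nonneg _)
        _ ≤ (|lam| + C) * 1 := mul_le_mul_of_nonneg_left h2 h4
        _ = _ := mul_one _
    · exact (hv.mul_left fun x => (lam + W x) * (u x * (h x * g x) * m x)).summable.congr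
        fun x => by rw [hvg x]; ring
  rw [t1, t2, ← t3] at hmain
  have t6 := mul_le_mul_of_nonneg_left (add_le_add (mul_le_mul_of_nonneg_left t4
    (by norm_num : (0 : ℝ) ≤ 10)) (mul_le_mul_of_nonneg_left t5 (by norm_num : (0 : ℝ) ≤ 2)))
    (inv_nonneg.mpr hT.le)
  linarith

end WeightedGraph
end

/-! ### Abstract closed forms: density and resolvent bounds. -/

noncomputable section

namespace ClosedForm

variable {E : Type*} [NormedAddCommGroup E] [InnerProductSpace ℝ E] (Q : ClosedForm E)

/-- Young's inequality, from nonnegativity of the form at `s • w - d`. -/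
theorem two_mul_form_le (w d : Q.domain) {s : ℝ} (hs : 0 < s) :
    2 * Q.form w d ≤ s * Q.form w w + s⁻¹ * Q.form d d := by
  have h := mul_nonneg (inv_nonneg.mpr hs.le) (Q.nonneg (s • w - d))
  simp only [map_sub, map_smul, LinearMap.sub_apply, LinearMap.smul_apply, smul_eq_mul] at h
  rw [Q.symm d w] at h
  have e : s⁻¹ * (s * (s * Q.form w w - Q.form w d) - (s * Q.form w d - Q.form d d)) =
      s⁻¹ * s * (s * Q.form w w) - 2 * (s⁻¹ * s) * Q.form w d + s⁻¹ * Q.form d d := by ring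
  rw [e, inv_mul_cancel₀ hs.ne'] at h
  linarith

theorem two_mul_inner_le (w d : E) {s : ℝ} (hs : 0 < s) :
    2 * |⟪w, d⟫_ℝ| ≤ s * ‖w‖ ^ 2 + s⁻¹ * ‖d‖ ^ 2 := by
  have h := mul_nonneg (inv_nonneg.mpr hs.le) (sq_nonneg (s * ‖w‖ - ‖d‖))
  have e : s⁻¹ * (s * ‖w‖ - ‖d‖) ^ 2 =
      s⁻¹ * s * (s * ‖w‖ ^ 2) - 2 * (s⁻¹ * s) * (‖w‖ * ‖d‖) + s⁻¹ * ‖d‖ ^ 2 := by ring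
  rw [e, inv_mul_cancel₀ hs.ne'] at h
  linarith [abs_real_inner_le_norm w d]

theorem energySq_le_two_mul (v v' : Q.domain) :
    Q.energySq v' ≤ 2 * Q.energySq v + 2 * Q.energySq (v - v') := by
  have h1 := Q.nonneg (v + (v - v'))
  have h2 := parallelogram_law_with_norm ℝ v (v - v')
  rw [sub_sub_cancel] at h2
  simp only [energySq]
  have h3 : Q.form (v + (v - v')) (v + (v - v')) + Q.form v' v' =
      2 * Q.form v v + 2 * Q.form (v - v') (v - v') := by
    simp only [map_sub, map_add, LinearMap.sub_apply, LinearMap.add_apply]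
    ring
  nlinarith [mul_self_nonneg ‖v + (v - v')‖]

/-- A quadratic upper bound for `Q(w, ·) - lam ⟪w, ·⟫` extends from a form core. -/
theorem le_of_core {core : Q.domain → Prop}
    (hcore : ∀ (v : Q.domain) (ε : ℝ), 0 < ε → ∃ v', core v' ∧ Q.energySq (v - v') < ε)
    {lam a b : ℝ} (hb : 0 ≤ b) (w : Q.domain)
    (h : ∀ v, core v → 2 * (Q.form w v - lam * ⟪(w : E), (v : E)⟫_ℝ) ≤ a + b * Q.energySq v)
    (v : Q.domain) :
    2 * (Q.form w v - lam * ⟪(w : E), (v : E)⟫_ℝ) ≤ a + b * (2 * Q.energySq v) := by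
  set K := (1 + |lam|) * Q.energySq w + (1 + |lam|) with hK
  -- Approximating within `s²` in squared energy and using Young with weight `s` makes every error
  -- `O(s)`. The factor 2 on the energy comes from `energySq_le_two_mul`.
  have step : ∀ s : ℝ, 0 < s → 2 * (Q.form w v - lam * ⟪(w : E), (v : E)⟫_ℝ) ≤
      a + b * (2 * Q.energySq v) + s * (2 * b * s + K) := by
    intro s hs
    obtain ⟨v', hv', hlt⟩ := hcore v (s ^ 2) (pow_pos hs 2)
    have h1 := h v' hv'
    have h2 := mul_le_mul_of_nonneg_left (Q.energySq_le_two_mul v v') hb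
    set d := v - v' with hd
    have hvd : v = v' + d := by rw [hd]; abel
    have e1 : Q.form w v = Q.form w v' + Q.form w d := by rw [hvd, map_add]
    have e2 : ⟪(w : E), (v : E)⟫_ℝ = ⟪(w : E), (v' : E)⟫_ℝ + ⟪(w : E), (d : E)⟫_ℝ := by
      rw [hvd, Submodule.coe_add, inner_add_right]
    have h3 := Q.two_mul_form_le w d hs
    have h4 : -(2 * (lam * ⟪(w : E), (d : E)⟫_ℝ)) ≤
        |lam| * (s * ‖(w : E)‖ ^ 2 + s⁻¹ * ‖(d : E)‖ ^ 2) := by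
      calc -(2 * (lam * ⟪(w : E), (d : E)⟫_ℝ)) ≤ |2 * (lam * ⟪(w : E), (d : E)⟫_ℝ)| :=
            neg_le_abs _
        _ = |lam| * (2 * |⟪(w : E), (d : E)⟫_ℝ|) := by
            rw [abs_mul, abs_mul, abs_two]; ring
        _ ≤ _ := mul_le_mul_of_nonneg_left (two_mul_inner_le _ _ hs) (abs_nonneg _)
    have h5 : s⁻¹ * Q.energySq d ≤ s := by
      rw [inv_mul_le_iff₀ hs, ← sq]
      exact hlt.le
    have h6 := mul_le_mul_of_nonneg_left h5 (add_nonneg zero_le_one (abs_nonneg lam))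
    have h7 := mul_le_mul_of_nonneg_left hlt.le hb
    have n1 : 0 ≤ |lam| * (s * Q.form w w) :=
      mul_nonneg (abs_nonneg _) (mul_nonneg hs.le (Q.nonneg w))
    have n2 : 0 ≤ |lam| * (s⁻¹ * Q.form d d) :=
      mul_nonneg (abs_nonneg _) (mul_nonneg (inv_nonneg.mpr hs.le) (Q.nonneg d))
    have n3 : 0 ≤ s * ‖(w : E)‖ ^ 2 := by positivity
    have n4 : 0 ≤ s⁻¹ * ‖(d : E)‖ ^ 2 := by positivity
    rw [e1, e2, hK]
    simp only [energySq, Submodule.coe_norm] at *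
    linarith
  have hlim : Filter.Tendsto
      (fun s : ℝ => a + b * (2 * Q.energySq v) + s * (2 * b * s + K))
      (nhdsWithin 0 (Set.Ioi 0)) (nhds (a + b * (2 * Q.energySq v))) := by
    have hc : Continuous fun s : ℝ => a + b * (2 * Q.energySq v) + s * (2 * b * s + K) := by
      fun_prop
    have := hc.tendsto 0
    rw [zero_mul, add_zero] at this
    exact this.mono_left nhdsWithin_le_nhds
  exact ge_of_tendsto hlim (Filter.eventually_of_mem self_mem_nhdsWithin fun s hs => step s hs)

/-- Off the spectrum, the equation `Q(ψ, ·) - lam ⟪ψ, ·⟫ = ⟪f, ·⟫` is solvable with a bound in the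
energy norm. -/
theorem exists_solution_of_inResolventSet {lam : ℝ} (h : InResolventSet Q.operator lam) :
    ∃ C : ℝ, 0 ≤ C ∧ ∀ f : E, ∃ ψ : Q.domain,
      (∀ v : Q.domain, Q.form ψ v - lam * ⟪(ψ : E), (v : E)⟫_ℝ = ⟪f, (v : E)⟫_ℝ) ∧
      Q.energySq ψ ≤ C * ‖f‖ ^ 2 := by
  obtain ⟨R, hR, -⟩ := h
  refine ⟨‖R‖ + (|lam| + 1) * ‖R‖ ^ 2, by positivity, fun f => ?_⟩
  obtain ⟨hdom, hf⟩ := hR f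
  have hmem : (R f, Q.operator ⟨R f, hdom⟩) ∈ Q.operator.graph :=
    Q.operator.mem_graph ⟨R f, hdom⟩
  rw [graph_operator] at hmem
  obtain ⟨hψ, hform⟩ := hmem
  simp only at hψ hform
  have hH : Q.operator ⟨R f, hdom⟩ = f + lam • R f := by
    rw [sub_eq_iff_eq_add] at hf
    exact hf
  rw [hH] at hform
  refine ⟨⟨R f, hψ⟩, fun v => ?_, ?_⟩
  · rw [hform v, inner_add_left, real_inner_smul_left]
    ring
  · rw [energySq, hform, Submodule.coe_norm, inner_add_left, real_inner_smul_left,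
      real_inner_self_eq_norm_sq]
    have h1 : ‖R f‖ ≤ ‖R‖ * ‖f‖ := R.le_opNorm f
    have h2 : ‖R f‖ ^ 2 ≤ ‖R‖ ^ 2 * ‖f‖ ^ 2 := by
      rw [← mul_pow]
      exact pow_le_pow_left₀ (norm_nonneg _) h1 2
    have h3 : ⟪f, R f⟫_ℝ ≤ ‖R‖ * ‖f‖ ^ 2 := by
      refine (real_inner_le_norm _ _).trans ?_
      calc ‖f‖ * ‖R f‖ ≤ ‖f‖ * (‖R‖ * ‖f‖) := mul_le_mul_of_nonneg_left h1 (norm_nonneg _)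
        _ = _ := by ring
    have h4 : lam * ‖R f‖ ^ 2 ≤ |lam| * ‖R f‖ ^ 2 :=
      mul_le_mul_of_nonneg_right (le_abs_self _) (sq_nonneg _)
    have h5 := mul_le_mul_of_nonneg_left h2 (add_nonneg (abs_nonneg lam) zero_le_one)
    linarith

end ClosedForm

/-! ### Pointwise description of `ℓ²(X, m)`. -/

section ell2

open MeasureTheory

variable {X : Type*} [MeasurableSpace X] {m : X → ℝ}

theorem inner_ell2 (hm : ∀ x, 0 < m x) [Countable X] [DiscreteMeasurableSpace X] (f g : ell2 m) :
    ⟪f, g⟫_ℝ = ∑' x, f x * g x * m x := by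
  rw [L2.inner_def]
  refine (integral_sum_dirac (x := fun x => x) fun x => ENNReal.ofReal_ne_top).trans
    (tsum_congr fun x => ?_)
  rw [ENNReal.toReal_ofReal (hm x).le, smul_eq_mul, RCLike.inner_apply, conj_trivial]
  ring

theorem pointMeasure_singleton [DiscreteMeasurableSpace X] (x : X) :
    pointMeasure m {x} = ENNReal.ofReal (m x) := by
  classical
  rw [pointMeasure, Measure.sum_apply _ (measurableSet_singleton x),
    tsum_eq_single x fun y hy => by simp [hy]]
  simp

theorem exists_ell2_of_finSupp (hm : ∀ x, 0 < m x) [DiscreteMeasurableSpace X] {v : X → ℝ}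
    (hv : FinSupp v) : ∃ f : ell2 m, (f : X → ℝ) = v := by
  classical
  have hv' : (Function.support v).Finite := hv
  have hmem : MemLp v 2 (pointMeasure m) := by
    have e : v = fun x => ∑ y ∈ hv'.toFinset, ({y} : Set X).indicator (fun _ => v y) x := by
      funext x
      simp only [Set.indicator_apply, Set.mem_singleton_iff]
      simp only [Finset.sum_ite_eq, Set.Finite.mem_toFinset, Function.mem_support, ite_not]
      split_ifs with h
      · exact h
      · rfl
    rw [e]
    exact memLp_finsetSum _ fun y _ => memLp_indicator_const 2 (measurableSet_singleton y) _
      (Or.inr (by rw [pointMeasure_singleton]; exact ENNReal.ofReal_ne_top))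
  refine ⟨hmem.toLp v, funext fun x => ?_⟩
  -- Every point has positive mass, so almost everywhere equality is equality everywhere.
  by_contra hne
  have h0 : pointMeasure m {x} = 0 := measure_mono_null
    (fun y hy => by rw [Set.mem_singleton_iff.mp hy]; exact hne) (ae_iff.mp hmem.coeFn_toLp)
  rw [pointMeasure_singleton, ENNReal.ofReal_eq_zero] at h0
  exact absurd (hm x) h0.not_gt

end ell2
end

/-! ### The contradiction with a bounded resolvent. -/

theorem theorem6p3 {X : Type*} [Countable X] [Infinite X]
    [MeasurableSpace X] [DiscreteMeasurableSpace X]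
    (m : X → ℝ) (hm : ∀ x, 0 < m x)
    (G : WeightedGraph X) (hG : G.toSimpleGraph.Connected)
    (c : X → ℝ) (Q : ClosedForm (ell2 m))
    (hQ : G.IsGraphForm Q c) (hreg : IsRegularDirichletForm Q)
    (W : X → ℝ) (hW : ∃ C : ℝ, ∀ x, |W x| ≤ C)
    (hcrit : G.Critical (WeightedGraph.shift m c W))
    (φ : X → ℝ) (hφ : G.GroundState (WeightedGraph.shift m c W) φ)
    (lam : ℝ) (u : X → ℝ) (hu : G.GeneralizedEigenfunction m c lam u)
    (hle : ∀ x, |u x| ≤ φ x) :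
    lam ∈ operatorSpectrum Q.operator := by
  intro hres
  obtain ⟨C, hC⟩ := hW
  obtain ⟨x₀, hx₀⟩ := Function.ne_iff.mp hu.1
  obtain ⟨D, hD, hsol⟩ := Q.exists_solution_of_inResolventSet hres
  have hC0 : 0 ≤ C := (abs_nonneg _).trans (hC x₀)
  set M := 10 + 12 * C + 2 * |lam| with hM
  have hM0 : 0 < M := by positivity
  -- Chosen so that `T⁻¹ M · 2 (D + 1) = 1`: the energy term of `ψ` then costs at most one of the
  -- two copies of `‖w‖²`. Using `D + 1` keeps `T` positive.
  set T := 2 * M * (D + 1) with hTdef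
  have hT : 0 < T := by positivity
  have hκ : 0 < u x₀ ^ 2 * m x₀ := mul_pos (by have : u x₀ ≠ 0 := hx₀; positivity) (hm x₀)
  obtain ⟨η, hη, hη1, hsmall⟩ := hcrit.exists_small hφ.1 x₀ (div_pos hκ hT)
  have hwfin : FinSupp fun x => u x * η x := hη.mul_left u
  obtain ⟨w, hw⟩ := exists_ell2_of_finSupp hm hwfin
  have hwQ : w ∈ Q.domain := hQ.1 w (by rw [hw]; exact hwfin)
  obtain ⟨ψ, hψ, hψE⟩ := hsol w
  have bound := Q.le_of_core hQ.2.1 (lam := lam) (b := T⁻¹ * M)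
    (mul_nonneg (inv_nonneg.mpr hT.le) hM0.le) ⟨w, hwQ⟩ (fun v hv => by
      have h1 := hu.cutoff_le hm hC hφ hle hη hv hT
      have h2 : Q.form ⟨w, hwQ⟩ v = G.bilin c (fun x => u x * η x) (v : ell2 m) := by
        rw [hQ.2.2, hw]
      have h3 : ‖(v : ell2 m)‖ ^ 2 = ∑' x, (v : ell2 m) x * (v : ell2 m) x * m x := by
        rw [← real_inner_self_eq_norm_sq, inner_ell2 hm]
      have h4 : ⟪w, (v : ell2 m)⟫_ℝ = ∑' x, u x * η x * (v : ell2 m) x * m x := by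
        rw [inner_ell2 hm, hw]
      rw [← h2, ← h3, ← h4, ← hQ.2.2] at h1
      refine h1.trans (add_le_add_right ?_ _)
      rw [mul_assoc]
      refine mul_le_mul_of_nonneg_left ?_ (inv_nonneg.mpr hT.le)
      have n1 : 0 ≤ (12 * C + 2 * |lam|) * Q.form v v :=
        mul_nonneg (by positivity) (Q.nonneg v)
      have n2 := sq_nonneg ‖(v : ell2 m)‖
      rw [ClosedForm.energySq, Submodule.coe_norm, hM]
      linarith) ψ
  have hself : Q.form ⟨w, hwQ⟩ ψ - lam * ⟪w, (ψ : ell2 m)⟫_ℝ = ‖w‖ ^ 2 := by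
    rw [Q.symm, real_inner_comm, ← real_inner_self_eq_norm_sq]
    exact hψ ⟨w, hwQ⟩
  have hlower : u x₀ ^ 2 * m x₀ ≤ ‖w‖ ^ 2 := by
    rw [← real_inner_self_eq_norm_sq, inner_ell2 hm, hw]
    have hs : Summable fun x => u x * η x * (u x * η x) * m x :=
      ((hwfin.mul_left fun x => u x * η x).mul_left m).summable.congr fun x => by ring
    refine le_trans (le_of_eq ?_) (hs.le_tsum x₀ fun x _ =>
      mul_nonneg (mul_self_nonneg _) (hm x).le)
    rw [hη1]
    ring
  have hcoef : T⁻¹ * M * (2 * Q.energySq ψ) ≤ ‖w‖ ^ 2 := by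
    have h1 : T⁻¹ * M * (2 * Q.energySq ψ) ≤ T⁻¹ * M * (2 * ((D + 1) * ‖w‖ ^ 2)) := by
      refine mul_le_mul_of_nonneg_left ?_ (mul_nonneg (inv_nonneg.mpr hT.le) hM0.le)
      linarith [sq_nonneg ‖w‖]
    refine h1.trans (le_of_eq ?_)
    calc T⁻¹ * M * (2 * ((D + 1) * ‖w‖ ^ 2)) = T⁻¹ * T * ‖w‖ ^ 2 := by rw [hTdef]; ring
      _ = ‖w‖ ^ 2 := by rw [inv_mul_cancel₀ hT.ne', one_mul]
  -- Now `2‖w‖² ≤ T Q_{b,c̃}(φη) + ‖w‖²`, while `T Q_{b,c̃}(φη) < u(x₀)² m(x₀) ≤ ‖w‖²`.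
  rw [hself] at bound
  have hlt := (lt_div_iff₀' hT).mp hsmall
  linarith
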